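/- A Markov decision process (MDP) is a tuple $\mathcal M=\langle Q,\mathsf A,\delta\rangle$ with a finite set $Q$ of states, a finite set $\mathsf A$ of actions and a transition function $\delta:Q\times\mathsf A\to\mathcal D(Q)$, where $\mathcal D(S)$ is the set of probability distributions over a finite set $S$. A finite path of length $n$ is a sequence $\rho=q_0a_0q_1\dots a_{n-1}q_n$ with $\delta(q_i,a_i)(q_{i+1})>0$ for all $i<n$. A strategy is a function $\alpha$ that maps every finite path to a distribution in $\mathcal D(\mathsf A)$. Given $d_0\in\mathcal D(Q)$ and a strategy $\alpha$, let $\mathcal M^\alpha_n\in\mathcal D(Q)$ be the distribution over states after $n$ steps; that is, $\mathcal M^\alpha_n(q)$ is the sum of $$d_0(q_0)\cdot\prod_{j=0}^{n-1}\alpha(q_0a_0\dots q_j)(a_j)\cdot\delta(q_j,a_j)(q_{j+1})$$ over all finite paths $q_0a_0\dots q_n$ of length $n$ with $q_n=q$. For $T\subseteq Q$ and $X\in\mathcal D(Q)$ let $\mathit{sum}_T(X)=\sum_{q\in T}X(q)$. For weak synchronization according to $\mathit{sum}_T$, the almost-sure winning region is the set of all $d_0\in\mathcal D(Q)$ for which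 there exists a strategy $\alpha$ such that for all $\epsilon>0$ we have $\mathit{sum}_T(\mathcal M^\alpha_n)\ge 1-\epsilon$ for infinitely many $n$. The limit-sure winning region is the set of all $d_0\in\mathcal D(Q)$ such that for all $\epsilon>0$ there exists a strategy $\alpha$ (which may depend on $\epsilon$) with $\mathit{sum}_T(\mathcal M^\alpha_n)\ge 1-\epsilon$ for infinitely many $n$. Theorem. For every MDP $\mathcal M$ and every target set $T\subseteq Q$, the limit-sure and the almost-sure winning regions for weak synchronization according to $\mathit{sum}_T$ coincide. -/

import Mathlib

/-- Probability distributions over a finite set `S`: nonnegative real functions of total sum `1`. -/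
abbrev ProbDist (S : Type*) [Fintype S] : Type _ := stdSimplex ℝ S

/-- A Markov decision process with state set `Q`, action set `A` and probabilistic transition
function `δ`. -/
structure MDP (Q A : Type*) [Fintype Q] where
  δ : Q → A → ProbDist Q

namespace MDP

variable {Q A : Type*} [Fintype Q]

/-- The support of `δ(q, a)`. -/
def post (M : MDP Q A) (q : Q) (a : A) : Set Q := {q' | 0 < (M.δ q a).1 q'}

/-- `M.FinPath n q` is the set of finite paths `q₀ a₀ q₁ a₁ … qₙ` of length `n` in `M` with last
state `qₙ = q`, where each `qᵢ₊₁` belongs to `post qᵢ aᵢ`. -/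
inductive FinPath (M : MDP Q A) : ℕ → Q → Type _
  | nil (q : Q) : FinPath M 0 q
  | snoc {n : ℕ} {q : Q} (ρ : FinPath M n q) (a : A) (q' : Q) (h : q' ∈ M.post q a) :
      FinPath M (n + 1) q'

/-- A finite path of length `0` is just a state. -/
def FinPath.equivZero (M : MDP Q A) (q : Q) : M.FinPath 0 q ≃ Unit where
  toFun _ := ()
  invFun _ := .nil q
  left_inv ρ := by cases ρ; rfl
  right_inv _ := rfl

/-- A finite path of length `n + 1` is a finite path of length `n` extended by one step. -/
def FinPath.equivSucc (M : MDP Q A) (n : ℕ) (q' : Q) :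
    M.FinPath (n + 1) q' ≃ (Σ q : Q, Σ a : A, M.FinPath n q × PLift (q' ∈ M.post q a)) where
  toFun ρ := match ρ with
    | .snoc (q := q) ρ a _ h => ⟨q, a, ρ, ⟨h⟩⟩
  invFun x := .snoc x.2.2.1 x.2.1 q' x.2.2.2.down
  left_inv ρ := by cases ρ; rfl
  right_inv _ := rfl

theorem FinPath.finite [Finite A] (M : MDP Q A) (n : ℕ) (q : Q) : Finite (M.FinPath n q) := by
  induction n generalizing q with
  | zero => exact Finite.of_equiv _ (FinPath.equivZero M q).symm
  | succ n ih =>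
    have := ih
    exact Finite.of_equiv _ (FinPath.equivSucc M n q).symm

noncomputable instance FinPath.instFintype [Finite A] (M : MDP Q A) (n : ℕ) (q : Q) :
    Fintype (M.FinPath n q) :=
  have := FinPath.finite M n q
  Fintype.ofFinite _

variable [Fintype A]

/-- A (randomized, history-dependent) strategy: a function from finite paths to distributions
over actions. -/
def Strategy (M : MDP Q A) : Type _ := ∀ ⦃n : ℕ⦄ ⦃q : Q⦄, M.FinPath n q → ProbDist A

/-- The probability `d₀(q₀) · ∏ⱼ α(q₀ a₀ … qⱼ)(aⱼ) · δ(qⱼ, aⱼ)(qⱼ₊₁)` of a finite path, under the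
strategy `α` from the initial distribution `d₀`. -/
def pathProb (M : MDP Q A) (α : M.Strategy) (d₀ : ProbDist Q) :
    ∀ {n : ℕ} {q : Q}, M.FinPath n q → ℝ
  | _, _, .nil q => d₀.1 q
  | _, _, .snoc (q := q) ρ a q' _ => pathProb M α d₀ ρ * ((α ρ).1 a * (M.δ q a).1 q')

/-- The probability to be in state `q` after exactly `n` steps: the total probability of the finite
paths of length `n` that end in `q`. -/
noncomputable def stateProb (M : MDP Q A) (α : M.Strategy) (d₀ : ProbDist Q) (n : ℕ) (q : Q) : ℝ :=
  ∑ ρ : M.FinPath n q, M.pathProb α d₀ ρ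

theorem pathProb_nonneg (M : MDP Q A) (α : M.Strategy) (d₀ : ProbDist Q) {n : ℕ} {q : Q}
    (ρ : M.FinPath n q) : 0 ≤ M.pathProb α d₀ ρ := by
  induction ρ with
  | nil q => exact d₀.2.1 q
  | snoc ρ a q' h ih => exact mul_nonneg ih (mul_nonneg ((α ρ).2.1 a) ((M.δ _ a).2.1 q'))

theorem stateProb_zero (M : MDP Q A) (α : M.Strategy) (d₀ : ProbDist Q) (q : Q) :
    M.stateProb α d₀ 0 q = d₀.1 q := by
  unfold stateProb
  rw [← (FinPath.equivZero M q).symm.sum_comp]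
  simp [FinPath.equivZero, pathProb]

theorem stateProb_succ (M : MDP Q A) (α : M.Strategy) (d₀ : ProbDist Q) (n : ℕ) (q' : Q) :
    M.stateProb α d₀ (n + 1) q' =
      ∑ q : Q, ∑ a : A, ∑ ρ : M.FinPath n q,
        M.pathProb α d₀ ρ * ((α ρ).1 a * (M.δ q a).1 q') := by
  classical
  unfold stateProb
  rw [← (FinPath.equivSucc M n q').symm.sum_comp, Fintype.sum_sigma]
  refine Finset.sum_congr rfl fun q _ => ?_
  rw [Fintype.sum_sigma]
  refine Finset.sum_congr rfl fun a _ => ?_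
  rw [Fintype.sum_prod_type]
  refine Finset.sum_congr rfl fun ρ _ => ?_
  by_cases h : q' ∈ M.post q a
  · rw [Fintype.sum_eq_single (⟨h⟩ : PLift (q' ∈ M.post q a))
      (fun x hx => absurd (Subsingleton.elim _ _) hx)]
    rfl
  · have h0 : (M.δ q a).1 q' = 0 := le_antisymm (not_lt.mp h) ((M.δ q a).2.1 q')
    have : IsEmpty (PLift (q' ∈ M.post q a)) := ⟨fun x => h x.down⟩
    simp [h0]

theorem stateProb_mem (M : MDP Q A) (α : M.Strategy) (d₀ : ProbDist Q) (n : ℕ) :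
    M.stateProb α d₀ n ∈ stdSimplex ℝ Q := by
  refine ⟨fun q => Finset.sum_nonneg fun ρ _ => M.pathProb_nonneg α d₀ ρ, ?_⟩
  induction n with
  | zero => simpa only [stateProb_zero] using d₀.2.2
  | succ n ih =>
    rw [← ih]
    simp only [stateProb_succ]
    rw [Finset.sum_comm]
    refine Finset.sum_congr rfl fun q _ => ?_
    rw [Finset.sum_comm]
    calc ∑ a : A, ∑ q' : Q, ∑ ρ : M.FinPath n q,
          M.pathProb α d₀ ρ * ((α ρ).1 a * (M.δ q a).1 q')
        = ∑ a : A, ∑ ρ : M.FinPath n q, M.pathProb α d₀ ρ * (α ρ).1 a := by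
          refine Finset.sum_congr rfl fun a _ => ?_
          rw [Finset.sum_comm]
          refine Finset.sum_congr rfl fun ρ _ => ?_
          rw [← Finset.mul_sum, ← Finset.mul_sum, (M.δ q a).2.2, mul_one]
      _ = M.stateProb α d₀ n q := by
          rw [Finset.sum_comm]
          refine Finset.sum_congr rfl fun ρ _ => ?_
          rw [← Finset.mul_sum, (α ρ).2.2, mul_one]

/-- The symbolic outcome of the strategy `α` from `d₀`: the sequence of the distributions over
states after `n` steps. -/
noncomputable def outcome (M : MDP Q A) (α : M.Strategy) (d₀ : ProbDist Q) (n : ℕ) : ProbDist Q :=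
  ⟨M.stateProb α d₀ n, M.stateProb_mem α d₀ n⟩

end MDP

/-- `sum_T`: the probability mass that a distribution puts on `T`. -/
def sumOn {Q : Type*} [Fintype Q] (T : Finset Q) (X : ProbDist Q) : ℝ := ∑ q ∈ T, X.1 q

/-- A distribution is `p`-synchronized according to `f` if its value under `f` is at least `p`. -/
def IsSynchronized {Q : Type*} [Fintype Q] (f : ProbDist Q → ℝ) (p : ℝ) (X : ProbDist Q) : Prop :=
  p ≤ f X

/-- A sequence of distributions is weakly `p`-synchronizing according to `f` if infinitely many of
its members are `p`-synchronized. -/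
def WeaklySynchronizing {Q : Type*} [Fintype Q] (f : ProbDist Q → ℝ) (p : ℝ) (X : ℕ → ProbDist Q) : Prop :=
  {n : ℕ | IsSynchronized f p (X n)}.Infinite

namespace MDP

variable {Q A : Type*} [Fintype Q] [Fintype A]

/-- The almost-sure winning region for weak synchronization: a single strategy works for all
`ε > 0`. -/
def winAlmostSureWeakly (M : MDP Q A) (f : ProbDist Q → ℝ) : Set (ProbDist Q) :=
  {d₀ | ∃ α : M.Strategy, ∀ ε : ℝ, 0 < ε → WeaklySynchronizing f (1 - ε) (M.outcome α d₀)}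

/-- The limit-sure winning region for weak synchronization: the strategy may depend on `ε > 0`. -/
def winLimitSureWeakly (M : MDP Q A) (f : ProbDist Q → ℝ) : Set (ProbDist Q) :=
  {d₀ | ∀ ε : ℝ, 0 < ε → ∃ α : M.Strategy, WeaklySynchronizing f (1 - ε) (M.outcome α d₀)}

end MDP

/-!
By compactness, limit-sure synchronization from `d₀` yields a distribution `e` with support
`S ⊆ T` each of whose neighbourhoods can be visited infinitely often. Two visits close to `e` show
that all states of `S` can return to `S` simultaneously with probability close to `1`.

As there are finitely many sets of states, the iterated predecessors of `S` are eventually periodic.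
Hence, for some `r > 0`, the optimal probabilities `v_(l + m * r)` to be in `S` after `l + m * r`
steps converge to limits `u_l` as `m → ∞`, which satisfy the Bellman equation and are `r`-periodic
in `l`; moreover `u_j` has expectation `1` under `d₀` for some `j`.

A strategy that only ever visits states with limit value `1` never loses the ability to
synchronize later. Restricting to such safe actions costs little: where the optimal action is
not safe, the hitting probability is at most `1 - b` for a uniform gap `b > 0`, so that
`1 - (1 - v_l) / b` is not positive there and bounds from below what safe play achieves.
Chaining safe play towards the deadlines `j + 2 ^ i * r` puts mass tending to `1` on `S`.
-/

open Filter Function Topology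

theorem exists_pos_le_of_pos {ι : Type*} [Finite ι] (f : ι → ℝ) :
    ∃ c > 0, c ≤ 1 ∧ ∀ i, 0 < f i → c ≤ f i := by
  have hle : ∀ᶠ c in 𝓝[>] (0 : ℝ), ∀ i, 0 < f i → c ≤ f i := by
    refine eventually_all.2 fun i => ?_
    by_cases hi : 0 < f i
    · filter_upwards [Ioc_mem_nhdsGT hi] with c hc _ using hc.2
    · exact Eventually.of_forall fun c h => absurd h hi
  have hone : ∀ᶠ c in 𝓝[>] (0 : ℝ), c ∈ Set.Ioc 0 1 := Ioc_mem_nhdsGT one_pos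
  obtain ⟨c, hc, hcf⟩ := (hone.and hle).exists
  exact ⟨c, hc.1, hc.2, hcf⟩

theorem exists_isPeriodicPt_iterate {α : Type*} [Finite α] (f : α → α) (x : α) :
    ∃ n > 0, IsPeriodicPt f n (f^[n] x) := by
  obtain ⟨a, r, hr, hper⟩ : ∃ a r, 0 < r ∧ IsPeriodicPt f r (f^[a] x) := by
    obtain ⟨a, b, hab, h⟩ := Set.finite_univ.exists_lt_map_eq_of_forall_mem
      (f := fun n => f^[n] x) fun _ => Set.mem_univ _
    refine ⟨a, b - a, Nat.sub_pos_of_lt hab, ?_⟩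
    rw [IsPeriodicPt, IsFixedPt, ← iterate_add_apply, Nat.sub_add_cancel hab.le, h]
  refine ⟨(a + 1) * r, by positivity, ?_⟩
  have ha : a ≤ (a + 1) * r := a.le_succ.trans (Nat.le_mul_of_pos_right _ hr)
  rw [← Nat.sub_add_cancel ha, iterate_add_apply, Nat.sub_add_cancel ha]
  exact (hper.const_mul (a + 1)).apply_iterate _

theorem indicator_one_le_one {α : Type*} (s : Set α) (x : α) : s.indicator (1 : α → ℝ) x ≤ 1 :=
  Set.indicator_le' (fun _ _ => le_rfl) (fun _ _ => zero_le_one) x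

theorem exists_next_value_of_strictMono {τ : ℕ → ℕ} (hτ : StrictMono τ) : ∃ d : ℕ → ℕ,
    (∀ t, t < d t ∧ d t ∈ Set.range τ) ∧ ∀ i t, τ i ≤ t → t < τ (i + 1) → d t = τ (i + 1) := by
  have hex : ∀ t, ∃ i, t < τ i := fun t => ⟨t + 1, hτ.le_apply⟩
  refine ⟨fun t => τ (Nat.find (hex t)), fun t => ⟨Nat.find_spec (hex t), _, rfl⟩,
    fun i t hit hti => congrArg τ ((Nat.find_eq_iff _).2 ⟨hti, fun n hn => ?_⟩)⟩
  exact ((hτ.monotone (Nat.lt_succ_iff.1 hn)).trans hit).not_gt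

namespace ProbDist

theorem nonempty {S : Type*} [Fintype S] (X : ProbDist S) : Nonempty S := by
  by_contra h
  rw [not_nonempty_iff] at h
  exact (stdSimplex_of_isEmpty_index (𝕜 := ℝ) (ι := S)).le X.2

variable {S : Type*} [Fintype S] (X : ProbDist S)

/-- The states of positive probability. -/
def support : Set S := {q | 0 < X.1 q}

/-- The expected value of `u` under the distribution `X`. -/
def expect (u : S → ℝ) : ℝ := ∑ q, X.1 q * u q

theorem expect_mono_of_support {u v : S → ℝ} (h : ∀ q ∈ X.support, u q ≤ v q) :
    X.expect u ≤ X.expect v := by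
  refine Finset.sum_le_sum fun q _ => ?_
  rcases (X.2.1 q).eq_or_lt with hq | hq
  · simp only [← hq, zero_mul, le_refl]
  · exact mul_le_mul_of_nonneg_left (h q hq) hq.le

theorem expect_mono {u v : S → ℝ} (h : ∀ q, u q ≤ v q) : X.expect u ≤ X.expect v :=
  X.expect_mono_of_support fun q _ => h q

theorem expect_affine (u : S → ℝ) (c d : ℝ) :
    X.expect (fun q => c * u q + d) = c * X.expect u + d := by
  calc X.expect (fun q => c * u q + d) = c * X.expect u + (∑ q, X.1 q) * d := by
        simp only [expect, Finset.mul_sum, Finset.sum_mul, ← Finset.sum_add_distrib]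
        exact Finset.sum_congr rfl fun q _ => by ring
    _ = c * X.expect u + d := by rw [X.2.2, one_mul]

theorem expect_const (d : ℝ) : X.expect (fun _ => d) = d := by
  simpa using X.expect_affine 0 0 d

theorem expect_le_one {u : S → ℝ} (hu : ∀ q, u q ≤ 1) : X.expect u ≤ 1 :=
  (X.expect_mono hu).trans_eq (X.expect_const 1)

theorem expect_nonneg {u : S → ℝ} (hu : ∀ q, 0 ≤ u q) : 0 ≤ X.expect u :=
  Finset.sum_nonneg fun q _ => mul_nonneg (X.2.1 q) (hu q)

theorem one_sub_expect (u : S → ℝ) : 1 - X.expect u = ∑ q, X.1 q * (1 - u q) := by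
  simp only [expect, mul_sub, mul_one, Finset.sum_sub_distrib, X.2.2]

theorem mul_one_sub_le_one_sub_expect {u : S → ℝ} (hu : ∀ q, u q ≤ 1) (q : S) :
    X.1 q * (1 - u q) ≤ 1 - X.expect u := by
  rw [one_sub_expect]
  exact Finset.single_le_sum (f := fun q => X.1 q * (1 - u q))
    (fun q _ => mul_nonneg (X.2.1 q) (sub_nonneg.2 (hu q))) (Finset.mem_univ q)

theorem expect_eq_one_iff {u : S → ℝ} (hu : ∀ q, u q ≤ 1) :
    X.expect u = 1 ↔ ∀ q ∈ X.support, u q = 1 := by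
  refine ⟨fun h q hq => ?_, fun h => le_antisymm (X.expect_le_one hu) ?_⟩
  · have := X.mul_one_sub_le_one_sub_expect hu q
    rw [h, sub_self] at this
    linarith [hu q, nonpos_of_mul_nonpos_right this hq]
  · rw [← X.expect_const 1]
    exact X.expect_mono_of_support fun q hq => (h q hq).ge

theorem continuous_expect_left (u : S → ℝ) : Continuous fun X : ProbDist S => X.expect u :=
  continuous_finsetSum _ fun q _ =>
    ((continuous_apply q).comp continuous_subtype_val).mul continuous_const

theorem continuous_expect : Continuous X.expect := by
  unfold expect
  fun_prop

theorem expect_vertex [DecidableEq S] (a : S) (u : S → ℝ) :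
    expect (stdSimplex.vertex a) u = u a := by
  simp [expect, Pi.single_apply]

theorem expect_indicator_one (T : Finset S) :
    X.expect ((T : Set S).indicator 1) = sumOn T X := by
  classical
  simp [expect, sumOn, Set.indicator_apply]

theorem expect_indicator_support : X.expect (X.support.indicator 1) = 1 :=
  (X.expect_eq_one_iff (indicator_one_le_one _)).2 fun _ hq => Set.indicator_of_mem hq 1

theorem sumOn_eq_one_iff {T : Finset S} : sumOn T X = 1 ↔ X.support ⊆ T := by
  rw [← expect_indicator_one, X.expect_eq_one_iff (indicator_one_le_one _)]
  refine forall₂_congr fun q _ => ?_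
  by_cases hq : q ∈ T <;> simp [hq]

theorem expect_indicator_le_sumOn {R : Set S} {T : Finset S} (h : R ⊆ T) :
    X.expect (R.indicator 1) ≤ sumOn T X := by
  rw [← expect_indicator_one]
  exact X.expect_mono (Set.indicator_le_indicator_of_subset h fun _ => zero_le_one)

end ProbDist

namespace MDP

section Bellman

variable {Q A : Type*} [Fintype Q] (M : MDP Q A)

/-- The sure predecessors of `X`: the states with an action all of whose possible successors are
in `X`. -/
def pre (X : Set Q) : Set Q := {q | ∃ a, M.post q a ⊆ X}

/-- The Bellman operator: the optimal expected value of `u` after one step. -/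
noncomputable def bellman (u : Q → ℝ) (q : Q) : ℝ := ⨆ a, (M.δ q a).expect u

/-- The optimal probability to be in `S` after exactly `n` steps. -/
noncomputable def hitValue (S : Set Q) (n : ℕ) : Q → ℝ := M.bellman^[n] (S.indicator 1)

theorem hitValue_zero (S : Set Q) : M.hitValue S 0 = S.indicator 1 := rfl

theorem hitValue_succ (S : Set Q) (n : ℕ) :
    M.hitValue S (n + 1) = M.bellman (M.hitValue S n) :=
  iterate_succ_apply' _ _ _

theorem bellman_iterate_hitValue (S : Set Q) (k n : ℕ) :
    M.bellman^[k] (M.hitValue S n) = M.hitValue S (n + k) := by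
  rw [hitValue, ← iterate_add_apply, add_comm, hitValue]

theorem hitValue_le_one [Nonempty A] (S : Set Q) (n : ℕ) (q : Q) : M.hitValue S n q ≤ 1 := by
  induction n generalizing q with
  | zero => exact indicator_one_le_one S q
  | succ n ih =>
    rw [hitValue_succ]
    exact ciSup_le fun a => (M.δ q a).expect_le_one ih

variable [Finite A]

theorem expect_le_bellman (u : Q → ℝ) (q : Q) (a : A) : (M.δ q a).expect u ≤ M.bellman u q :=
  le_ciSup (Set.finite_range fun a => (M.δ q a).expect u).bddAbove a

variable [Nonempty A]

theorem exists_expect_eq_bellman (u : Q → ℝ) (q : Q) :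
    ∃ a, (M.δ q a).expect u = M.bellman u q :=
  exists_eq_ciSup_of_finite

theorem continuous_bellman : Continuous M.bellman := by
  have := Fintype.ofFinite A
  refine continuous_pi fun q => ?_
  simp only [bellman, ← Finset.sup'_univ_eq_ciSup]
  exact Continuous.finset_sup'_apply _ fun a _ => (M.δ q a).continuous_expect

theorem bellman_iterate_le_affine {u v : Q → ℝ} {c d : ℝ} (hc : 0 ≤ c)
    (h : ∀ q, u q ≤ c * v q + d) (n : ℕ) (q : Q) :
    M.bellman^[n] u q ≤ c * M.bellman^[n] v q + d := by
  induction n generalizing q with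
  | zero => exact h q
  | succ n ih =>
    simp only [iterate_succ_apply']
    obtain ⟨a, ha⟩ := M.exists_expect_eq_bellman (M.bellman^[n] u) q
    calc M.bellman (M.bellman^[n] u) q
        = (M.δ q a).expect (M.bellman^[n] u) := ha.symm
      _ ≤ c * (M.δ q a).expect (M.bellman^[n] v) + d :=
        ((M.δ q a).expect_mono ih).trans_eq ((M.δ q a).expect_affine _ _ _)
      _ ≤ c * M.bellman (M.bellman^[n] v) q + d := by
        gcongr
        exact M.expect_le_bellman _ q a

theorem bellman_iterate_le_add {u v : Q → ℝ} {d : ℝ} (h : ∀ q, u q ≤ v q + d) (n : ℕ) (q : Q) :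
    M.bellman^[n] u q ≤ M.bellman^[n] v q + d := by
  simpa only [one_mul] using
    M.bellman_iterate_le_affine zero_le_one (by simpa only [one_mul] using h) n q

theorem bellman_eq_one_iff {u : Q → ℝ} (hu : ∀ q, u q ≤ 1) (q : Q) :
    M.bellman u q = 1 ↔ q ∈ M.pre {q | u q = 1} := by
  have hpost (a : A) : M.post q a ⊆ {q | u q = 1} ↔ (M.δ q a).expect u = 1 :=
    ((M.δ q a).expect_eq_one_iff hu).symm
  simp only [pre, Set.mem_ofPred_eq, hpost]
  constructor
  · intro h
    obtain ⟨a, ha⟩ := M.exists_expect_eq_bellman u q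
    exact ⟨a, ha.trans h⟩
  · rintro ⟨a, ha⟩
    exact le_antisymm (ciSup_le fun a => (M.δ q a).expect_le_one hu)
      (ha.ge.trans (M.expect_le_bellman u q a))

variable (S : Set Q)

theorem hitValue_nonneg (n : ℕ) (q : Q) : 0 ≤ M.hitValue S n q := by
  induction n generalizing q with
  | zero => exact Set.indicator_nonneg (fun _ _ => zero_le_one) q
  | succ n ih =>
    obtain ⟨a, ha⟩ := M.exists_expect_eq_bellman (M.hitValue S n) q
    rw [hitValue_succ, ← ha]
    exact (M.δ q a).expect_nonneg ih

theorem hitValue_eq_one_iff (n : ℕ) (q : Q) : M.hitValue S n q = 1 ↔ q ∈ M.pre^[n] S := by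
  induction n generalizing q with
  | zero => by_cases hq : q ∈ S <;> simp [hitValue_zero, hq]
  | succ n ih =>
    have hset : {q | M.hitValue S n q = 1} = M.pre^[n] S := Set.ext ih
    rw [hitValue_succ, bellman_eq_one_iff _ (M.hitValue_le_one S n), hset, iterate_succ_apply']

variable {S}

theorem indicator_one_le_hitValue_add {R : Set Q} {n : ℕ} {ε : ℝ} (hε : 0 ≤ ε)
    (h : ∀ q ∈ R, 1 - ε ≤ M.hitValue S n q) (q : Q) :
    R.indicator 1 q ≤ M.hitValue S n q + ε :=
  Set.indicator_le' (g := fun q => M.hitValue S n q + ε) (fun q hq => sub_le_iff_le_add.1 (h q hq))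
    (fun q _ => add_nonneg (M.hitValue_nonneg S n q) hε) q

end Bellman

section Recurrence

variable {Q A : Type*} [Fintype Q] (M : MDP Q A) (S : Set Q)

/-- From every state of `S` one can be back in `S` after exactly `n > 0` steps with probability
arbitrarily close to `1`, where `n` does not depend on the state. -/
def IsLimitRecurrent : Prop :=
  ∀ ε : ℝ, 0 < ε → ∃ n > 0, ∀ q ∈ S, 1 - ε ≤ M.hitValue S n q

/-- From every state of `S`, the optimal probability to be back in `S` after exactly `m * r` steps
tends to `1` as `m → ∞`. -/
def IsPeriodicallyRecurrent (r : ℕ) : Prop :=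
  ∀ ε : ℝ, 0 < ε → ∀ᶠ m in atTop, ∀ q ∈ S, 1 - ε ≤ M.hitValue S (m * r) q

variable [Finite A] [Nonempty A]

-- `M.pre^[r] S` is stable under `M.pre^[r]`, so a state with `hitValue S r = 1` keeps that value at
-- all later multiples of `r`; the other states are bounded away from `1`.
theorem exists_hitValue_le_affine : ∃ r > 0, ∃ c > 0, ∀ m > 0, ∀ k q,
    M.hitValue S (m * r) q ≤ c * M.hitValue S ((m + k) * r) q + (1 - c) := by
  obtain ⟨r, hr, hper⟩ := exists_isPeriodicPt_iterate M.pre S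
  obtain ⟨c, hc, -, hgap⟩ := exists_pos_le_of_pos fun q => 1 - M.hitValue S r q
  have hone (k : ℕ) {q : Q} (hq : M.hitValue S r q = 1) : M.hitValue S (r + k * r) q = 1 := by
    rw [hitValue_eq_one_iff] at hq ⊢
    rwa [add_comm, iterate_add_apply, mul_comm, (hper.mul_const k).eq]
  have hle (k : ℕ) (q : Q) :
      M.hitValue S r q ≤ c * M.hitValue S (r + k * r) q + (1 - c) := by
    rcases (M.hitValue_le_one S r q).eq_or_lt with hq | hq
    · rw [hone k hq, hq, mul_one, add_sub_cancel]
    · have := mul_nonneg hc.le (M.hitValue_nonneg S (r + k * r) q)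
      linarith [hgap q (sub_pos.2 hq)]
  refine ⟨r, hr, c, hc, fun m hm k q => ?_⟩
  obtain ⟨m, rfl⟩ := Nat.exists_eq_add_one.2 hm
  have := M.bellman_iterate_le_affine hc.le (hle k) (m * r) q
  simp only [bellman_iterate_hitValue] at this
  convert this using 4 <;> ring

variable {M S}

theorem indicator_one_le_hitValue_mul_add {n : ℕ} {ε : ℝ}
    (h : ∀ q, S.indicator 1 q ≤ M.hitValue S n q + ε) (j : ℕ) (q : Q) :
    S.indicator 1 q ≤ M.hitValue S (n * j) q + j * ε := by
  induction j with
  | zero => simp [hitValue_zero]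
  | succ j ih =>
    have hstep : M.hitValue S (n * j) q ≤ M.hitValue S (n * (j + 1)) q + ε := by
      rw [Nat.mul_succ, add_comm (n * j), ← bellman_iterate_hitValue]
      exact M.bellman_iterate_le_add h (n * j) q
    push_cast
    linarith

theorem IsLimitRecurrent.exists_mul (h : M.IsLimitRecurrent S) {r : ℕ} (hr : 0 < r) {ε : ℝ}
    (hε : 0 < ε) : ∃ n > 0, ∀ q ∈ S, 1 - ε ≤ M.hitValue S (n * r) q := by
  obtain ⟨n, hn, hret⟩ := h (ε / r) (by positivity)
  refine ⟨n, hn, fun q hq => ?_⟩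
  have := indicator_one_le_hitValue_mul_add
    (M.indicator_one_le_hitValue_add (by positivity) hret) r q
  rw [Set.indicator_of_mem hq, Pi.one_apply, mul_div_cancel₀ ε (by positivity)] at this
  linarith

theorem IsLimitRecurrent.exists_isPeriodicallyRecurrent (h : M.IsLimitRecurrent S) :
    ∃ r > 0, M.IsPeriodicallyRecurrent S r := by
  obtain ⟨r, hr, c, hc, hle⟩ := M.exists_hitValue_le_affine S
  refine ⟨r, hr, fun ε hε => ?_⟩
  obtain ⟨n, hn, hret⟩ := h.exists_mul hr (mul_pos hc hε)
  filter_upwards [eventually_ge_atTop n] with m hm q hq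
  obtain ⟨k, rfl⟩ := Nat.exists_eq_add_of_le hm
  have : c * (1 - ε) ≤ c * M.hitValue S ((n + k) * r) q := by linarith [hret q hq, hle n hn k q]
  exact le_of_mul_le_mul_left this hc

end Recurrence

section LimitValue

variable {Q A : Type*} [Fintype Q] (M : MDP Q A) (S : Set Q) (r : ℕ)

/-- The limit of the optimal probabilities to be in `S` after exactly `l + m * r` steps as `m → ∞`.
It is encoded as a supremum; see `MDP.tendsto_limitValue`. -/
noncomputable def limitValue (l : ℕ) (q : Q) : ℝ := ⨆ m : ℕ, M.hitValue S (l + m * r) q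

theorem hitValue_le_limitValue [Nonempty A] (l m : ℕ) (q : Q) :
    M.hitValue S (l + m * r) q ≤ M.limitValue S r l q :=
  le_ciSup (f := fun m => M.hitValue S (l + m * r) q)
    ⟨1, Set.forall_mem_range.2 fun _ => M.hitValue_le_one S _ q⟩ m

theorem limitValue_le_one [Nonempty A] (l : ℕ) (q : Q) : M.limitValue S r l q ≤ 1 :=
  ciSup_le fun _ => M.hitValue_le_one S _ q

variable [Finite A] [Nonempty A]
variable {M S r} (hS : M.IsPeriodicallyRecurrent S r)
include hS

theorem eventually_hitValue_le_add {ε : ℝ} (hε : 0 < ε) :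
    ∀ᶠ m in atTop, ∀ l q, M.hitValue S l q ≤ M.hitValue S (l + m * r) q + ε := by
  filter_upwards [hS ε hε] with m hm l q
  rw [add_comm l, ← bellman_iterate_hitValue]
  exact M.bellman_iterate_le_add (M.indicator_one_le_hitValue_add hε.le hm) l q

theorem tendsto_limitValue (l : ℕ) :
    Tendsto (fun m => M.hitValue S (l + m * r)) atTop (𝓝 (M.limitValue S r l)) := by
  refine tendsto_pi_nhds.2 fun q => tendsto_order.2 ⟨fun a ha => ?_, fun a ha =>
    Eventually.of_forall fun m => (M.hitValue_le_limitValue S r l m q).trans_lt ha⟩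
  obtain ⟨m₀, hm₀⟩ := exists_lt_of_lt_ciSup ha
  have hpos : 0 < (M.hitValue S (l + m₀ * r) q - a) / 2 := half_pos (sub_pos.2 hm₀)
  filter_upwards [(tendsto_sub_atTop_nat m₀).eventually (eventually_hitValue_le_add hS hpos),
    eventually_ge_atTop m₀] with m hm hge
  have := hm (l + m₀ * r) q
  rw [add_assoc, ← add_mul, Nat.add_sub_cancel' hge] at this
  linarith

theorem periodic_limitValue : Periodic (M.limitValue S r) r := fun l => by
  refine tendsto_nhds_unique (tendsto_limitValue hS (l + r)) ?_
  have := (tendsto_limitValue hS l).comp (tendsto_add_atTop_nat 1)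
  simpa only [comp_def, add_one_mul, add_assoc, add_comm r] using this

theorem bellman_limitValue (l : ℕ) :
    M.bellman (M.limitValue S r l) = M.limitValue S r (l + 1) := by
  have := (M.continuous_bellman.tendsto _).comp (tendsto_limitValue hS l)
  refine tendsto_nhds_unique this ?_
  simpa only [comp_def, ← hitValue_succ, add_right_comm _ 1] using tendsto_limitValue hS (l + 1)

theorem limitValue_sub_eq {x y t : ℕ} (hxy : x ≡ y [MOD r]) (hx : t ≤ x) (hy : t ≤ y) :
    M.limitValue S r (x - t) = M.limitValue S r (y - t) := by
  have hmod : (x - t) % r = (y - t) % r := by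
    refine Nat.ModEq.add_right_cancel' t ?_
    rwa [Nat.sub_add_cancel hx, Nat.sub_add_cancel hy]
  rw [← (periodic_limitValue hS).map_mod_nat, hmod, (periodic_limitValue hS).map_mod_nat]

theorem exists_expect_limitValue_eq_one (hr : 0 < r) {d₀ : ProbDist Q}
    (hd₀ : ∀ ε : ℝ, 0 < ε → ∃ n, 1 - ε ≤ d₀.expect (M.hitValue S n)) :
    ∃ j, d₀.expect (M.limitValue S r j) = 1 := by
  have : NeZero r := ⟨hr.ne'⟩
  obtain ⟨j, hj⟩ := Finite.exists_max fun i : Fin r => d₀.expect (M.limitValue S r i)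
  refine ⟨j, le_antisymm (d₀.expect_le_one (M.limitValue_le_one S r j)) ?_⟩
  refine le_of_forall_sub_le fun ε hε => ?_
  obtain ⟨n, hn⟩ := hd₀ ε hε
  calc 1 - ε ≤ d₀.expect (M.hitValue S n) := hn
    _ ≤ d₀.expect (M.limitValue S r n) := d₀.expect_mono fun q => by
      simpa using M.hitValue_le_limitValue S r n 0 q
    _ = d₀.expect (M.limitValue S r (n % r)) := by rw [(periodic_limitValue hS).map_mod_nat]
    _ ≤ d₀.expect (M.limitValue S r j) := hj ⟨n % r, Nat.mod_lt n hr⟩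

end LimitValue

section SafePolicy

variable {Q A : Type*} [Fintype Q] (M : MDP Q A) (S : Set Q) (r : ℕ) (b : ℝ)

/-- The lower bound on the probability to hit `S` after `l` steps that is maintained by a policy
which only loses a factor `1 / b` of the missing mass `1 - M.hitValue S l q`. -/
noncomputable def safeValue (l : ℕ) (q : Q) : ℝ := max 0 (1 - (1 - M.hitValue S l q) / b)

/-- A Markov policy, indexed by the number `l` of steps that remain after the current one, that
never leaves the states with limit value `1` and under which `MDP.safeValue` does not decrease. -/
def IsSafePolicy (g : ℕ → Q → A) : Prop := ∀ l q, M.limitValue S r (l + 1) q = 1 →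
  (M.δ q (g l q)).expect (M.limitValue S r l) = 1 ∧
    M.safeValue S b (l + 1) q ≤ (M.δ q (g l q)).expect (M.safeValue S b l)

variable {M S r b}

theorem safeValue_zero_le (hb : 0 < b) (hb1 : b ≤ 1) (q : Q) :
    M.safeValue S b 0 q ≤ S.indicator 1 q := by
  rw [safeValue, hitValue_zero]
  by_cases hq : q ∈ S
  · simp [hq]
  · simpa [hq] using one_le_inv_iff₀.2 ⟨hb, hb1⟩

theorem safeValue_le_expect {l : ℕ} {q : Q} {a : A}
    (ha : (M.δ q a).expect (M.hitValue S l) = M.bellman (M.hitValue S l) q) :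
    M.safeValue S b (l + 1) q ≤ (M.δ q a).expect (M.safeValue S b l) := by
  refine max_le ((M.δ q a).expect_nonneg fun _ => le_max_left _ _) ?_
  calc 1 - (1 - M.hitValue S (l + 1) q) / b
      = b⁻¹ * (M.δ q a).expect (M.hitValue S l) + (1 - b⁻¹) := by
        rw [hitValue_succ, ← ha]
        ring
    _ = (M.δ q a).expect fun q' => b⁻¹ * M.hitValue S l q' + (1 - b⁻¹) :=
        ((M.δ q a).expect_affine _ _ _).symm
    _ ≤ (M.δ q a).expect (M.safeValue S b l) := (M.δ q a).expect_mono fun q' =>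
        le_max_of_le_right (by ring_nf; rfl)

theorem safeValue_eq_zero (hb : 0 < b) {l : ℕ} {q : Q} (h : M.hitValue S l q ≤ 1 - b) :
    M.safeValue S b l q = 0 := by
  refine max_eq_left (sub_nonpos.2 ((one_le_div hb).2 ?_))
  linarith

variable [Finite A] [Nonempty A] (hS : M.IsPeriodicallyRecurrent S r)
include hS

theorem exists_expect_limitValue_gap (hr : 0 < r) : ∃ b > 0, b ≤ 1 ∧ ∀ l q a,
    (M.δ q a).expect (M.limitValue S r l) ≠ 1 →
      (M.δ q a).expect (M.limitValue S r l) ≤ 1 - b := by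
  obtain ⟨b, hb, hb1, hgap⟩ := exists_pos_le_of_pos
    fun p : Fin r × Q × A => 1 - (M.δ p.2.1 p.2.2).expect (M.limitValue S r p.1)
  refine ⟨b, hb, hb1, fun l q a hne => ?_⟩
  have hlt := ((M.δ q a).expect_le_one (M.limitValue_le_one S r l)).lt_of_ne hne
  rw [← (periodic_limitValue hS).map_mod_nat] at hlt ⊢
  linarith [hgap (⟨l % r, Nat.mod_lt l hr⟩, q, a) (sub_pos.2 hlt)]

theorem exists_isSafePolicy (hr : 0 < r) :
    ∃ b > 0, b ≤ 1 ∧ ∃ g : ℕ → Q → A, M.IsSafePolicy S r b g := by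
  obtain ⟨b, hb, hb1, hgap⟩ := exists_expect_limitValue_gap hS hr
  suffices h : ∀ l q, M.limitValue S r (l + 1) q = 1 → ∃ a : A,
      (M.δ q a).expect (M.limitValue S r l) = 1 ∧
        M.safeValue S b (l + 1) q ≤ (M.δ q a).expect (M.safeValue S b l) by
    choose! g hg using h
    exact ⟨b, hb, hb1, g, hg⟩
  intro l q hq
  obtain ⟨a, ha⟩ := M.exists_expect_eq_bellman (M.hitValue S l) q
  by_cases hsafe : (M.δ q a).expect (M.limitValue S r l) = 1
  · exact ⟨a, hsafe, safeValue_le_expect ha⟩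
  -- If the optimal action is not safe then `safeValue` is `0` at `q`, so any safe action will do.
  · obtain ⟨a', ha'⟩ := M.exists_expect_eq_bellman (M.limitValue S r l) q
    refine ⟨a', by rw [ha', bellman_limitValue hS, hq], ?_⟩
    have hle : M.hitValue S (l + 1) q ≤ 1 - b := by
      rw [hitValue_succ, ← ha]
      refine ((M.δ q a).expect_mono fun q' => ?_).trans (hgap l q a hsafe)
      simpa using M.hitValue_le_limitValue S r l 0 q'
    rw [safeValue_eq_zero hb hle]
    exact (M.δ q a').expect_nonneg fun _ => le_max_left _ _

theorem eventually_le_safeValue (hb : 0 < b) {ε : ℝ} (hε : 0 < ε) :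
    ∀ᶠ m in atTop, ∀ q, M.limitValue S r 0 q = 1 → 1 - ε ≤ M.safeValue S b (m * r) q := by
  refine eventually_all.2 fun q => ?_
  filter_upwards [(tendsto_pi_nhds.1 (tendsto_limitValue hS 0) q).eventually_const_lt
    (sub_lt_self _ (mul_pos hε hb))] with m hm hq
  rw [hq, zero_add] at hm
  have : (1 - M.hitValue S (m * r) q) / b ≤ ε := (div_le_iff₀ hb).2 (by linarith)
  exact le_max_of_le_right (by linarith)

end SafePolicy

section Strategy

variable {Q A : Type*} [Fintype Q] [Fintype A] (M : MDP Q A)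

theorem outcome_zero (α : M.Strategy) (d₀ : ProbDist Q) : M.outcome α d₀ 0 = d₀ :=
  Subtype.ext (funext (M.stateProb_zero α d₀))

theorem expect_outcome (α : M.Strategy) (d₀ : ProbDist Q) (n : ℕ) (u : Q → ℝ) :
    (M.outcome α d₀ n).expect u = ∑ q, ∑ ρ : M.FinPath n q, M.pathProb α d₀ ρ * u q := by
  simp only [ProbDist.expect, outcome, stateProb, Finset.sum_mul]

theorem expect_outcome_succ (α : M.Strategy) (d₀ : ProbDist Q) (n : ℕ) (u : Q → ℝ) :
    (M.outcome α d₀ (n + 1)).expect u = ∑ q, ∑ ρ : M.FinPath n q,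
      M.pathProb α d₀ ρ * (α ρ).expect fun a => (M.δ q a).expect u := by
  simp only [ProbDist.expect, outcome, stateProb_succ, Finset.sum_mul, Finset.mul_sum]
  rw [Finset.sum_comm]
  refine Finset.sum_congr rfl fun q _ => ?_
  rw [Finset.sum_comm_cycle]
  refine Finset.sum_congr rfl fun ρ _ => ?_
  rw [Finset.sum_comm]
  exact Finset.sum_congr rfl fun a _ => Finset.sum_congr rfl fun q' _ => by ring

theorem expect_outcome_add_le (α : M.Strategy) (d₀ : ProbDist Q) (u : Q → ℝ) (n k : ℕ) :
    (M.outcome α d₀ (n + k)).expect u ≤ (M.outcome α d₀ n).expect (M.bellman^[k] u) := by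
  induction k generalizing u with
  | zero => rfl
  | succ k ih =>
    calc (M.outcome α d₀ (n + k + 1)).expect u
        ≤ (M.outcome α d₀ (n + k)).expect (M.bellman u) := by
          rw [expect_outcome_succ, expect_outcome]
          gcongr with q _ ρ _
          · exact M.pathProb_nonneg α d₀ ρ
          · exact ((α ρ).expect_mono (M.expect_le_bellman u q)).trans_eq ((α ρ).expect_const _)
      _ ≤ (M.outcome α d₀ n).expect (M.bellman^[k] (M.bellman u)) := ih _

open Classical in
/-- The strategy that plays the action `σ n q` in the state `q` after `n` steps. -/
noncomputable def markovStrategy (σ : ℕ → Q → A) : M.Strategy :=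
  fun n q _ => stdSimplex.vertex (σ n q)

theorem expect_outcome_markovStrategy_succ (σ : ℕ → Q → A) (d₀ : ProbDist Q) (n : ℕ)
    (u : Q → ℝ) :
    (M.outcome (M.markovStrategy σ) d₀ (n + 1)).expect u =
      (M.outcome (M.markovStrategy σ) d₀ n).expect fun q => (M.δ q (σ n q)).expect u := by
  simp only [expect_outcome_succ, expect_outcome, markovStrategy, ProbDist.expect_vertex]

end Strategy

section DeadlineStrategy

variable {Q A : Type*} [Fintype Q] [Fintype A] {M : MDP Q A} {S : Set Q} {r : ℕ} {b : ℝ}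
  {g : ℕ → Q → A} {d : ℕ → ℕ} {d₀ : ProbDist Q}

/-- The strategy that follows the policy `g`, which is indexed by the number of remaining steps,
towards the deadline `d t` that is current at time `t`. -/
noncomputable def deadlineStrategy (M : MDP Q A) (g : ℕ → Q → A) (d : ℕ → ℕ) : M.Strategy :=
  M.markovStrategy fun t => g (d t - (t + 1))

theorem expect_outcome_deadlineStrategy_succ (t : ℕ) (u : Q → ℝ) :
    (M.outcome (M.deadlineStrategy g d) d₀ (t + 1)).expect u =
      (M.outcome (M.deadlineStrategy g d) d₀ t).expect
        fun q => (M.δ q (g (d t - (t + 1)) q)).expect u :=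
  M.expect_outcome_markovStrategy_succ _ d₀ t u

variable [Nonempty A] (hg : M.IsSafePolicy S r b g)
include hg

theorem IsSafePolicy.expect_limitValue_eq_one (hS : M.IsPeriodicallyRecurrent S r) {j : ℕ}
    (hd : ∀ t, t < d t) (hdj : ∀ t, d t ≡ j [MOD r]) (hd₀ : d₀.expect (M.limitValue S r j) = 1)
    (t : ℕ) :
    (M.outcome (M.deadlineStrategy g d) d₀ t).expect (M.limitValue S r (d t - t)) = 1 := by
  induction t with
  | zero => rwa [outcome_zero, limitValue_sub_eq hS (hdj 0) (Nat.zero_le _) (Nat.zero_le _)]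
  | succ t ih =>
    rw [limitValue_sub_eq hS ((hdj (t + 1)).trans (hdj t).symm) (hd (t + 1)).le (hd t),
      expect_outcome_deadlineStrategy_succ, ProbDist.expect_eq_one_iff _ fun q =>
        (M.δ q _).expect_le_one (M.limitValue_le_one S r _)]
    rw [ProbDist.expect_eq_one_iff _ (M.limitValue_le_one S r _)] at ih
    refine fun q hq => (hg _ q ?_).1
    rw [← ih q hq]
    congr 1
    have := hd t
    omega

theorem IsSafePolicy.expect_safeValue_le {D : ℕ}
    (hone : ∀ t, (M.outcome (M.deadlineStrategy g d) d₀ t).expect (M.limitValue S r (d t - t)) = 1)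
    (l t : ℕ) (hD : t + l = D) (hd : ∀ s, t ≤ s → s < D → d s = D) :
    (M.outcome (M.deadlineStrategy g d) d₀ t).expect (M.safeValue S b l) ≤
      (M.outcome (M.deadlineStrategy g d) d₀ D).expect (M.safeValue S b 0) := by
  induction l generalizing t with
  | zero => rw [← hD, add_zero]
  | succ l ih =>
    refine le_trans ?_ (ih (t + 1) (by omega) fun s hs => hd s (Nat.le_of_succ_le hs))
    have hdt : d t = D := hd t le_rfl (by omega)
    have hl : d t - (t + 1) = l := by omega
    have hsupp := hone t
    rw [ProbDist.expect_eq_one_iff _ (M.limitValue_le_one S r _), hdt, ← hD,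
      Nat.add_sub_cancel_left] at hsupp
    rw [expect_outcome_deadlineStrategy_succ, hl]
    exact ProbDist.expect_mono_of_support _ fun q hq => (hg l q (hsupp q hq)).2

theorem IsSafePolicy.exists_frequently_le_expect (hS : M.IsPeriodicallyRecurrent S r)
    (hr : 0 < r) (hb : 0 < b) (hb1 : b ≤ 1) {j : ℕ} (hd₀ : d₀.expect (M.limitValue S r j) = 1) :
    ∃ α : M.Strategy, ∀ ε : ℝ, 0 < ε →
      ∃ᶠ t in atTop, 1 - ε ≤ (M.outcome α d₀ t).expect (S.indicator 1) := by
  set τ : ℕ → ℕ := fun i => j + 2 ^ i * r with hτ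
  have hτmono : StrictMono τ := fun i k hik => by simp only [hτ]; gcongr; exact one_lt_two
  have hτsucc (i : ℕ) : τ i + 2 ^ i * r = τ (i + 1) := by simp only [hτ]; ring
  obtain ⟨d, hd, hdτ⟩ := exists_next_value_of_strictMono hτmono
  have hdj (t : ℕ) : d t ≡ j [MOD r] := by
    obtain ⟨i, hi⟩ := (hd t).2
    simp [← hi, hτ, Nat.ModEq]
  have hone := hg.expect_limitValue_eq_one hS (fun t => (hd t).1) hdj hd₀
  refine ⟨M.deadlineStrategy g d, fun ε hε => ?_⟩
  have hlarge := (tendsto_pow_atTop_atTop_of_one_lt one_lt_two).eventually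
    (eventually_le_safeValue hS hb hε)
  refine (hτmono.tendsto_atTop.comp (tendsto_add_atTop_nat 1)).frequently
    (hlarge.mono fun i hi => ?_).frequently
  have hsupp := hone (τ i)
  rw [hdτ i _ le_rfl (hτmono i.lt_succ_self), ← hτsucc, Nat.add_sub_cancel_left,
    ← (periodic_limitValue hS).map_mod_nat, Nat.mul_mod_left,
    ProbDist.expect_eq_one_iff _ (M.limitValue_le_one S r _)] at hsupp
  calc 1 - ε = (M.outcome (M.deadlineStrategy g d) d₀ (τ i)).expect fun _ => 1 - ε :=
        (ProbDist.expect_const _ _).symm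
    _ ≤ (M.outcome _ d₀ (τ i)).expect (M.safeValue S b (2 ^ i * r)) :=
        ProbDist.expect_mono_of_support _ fun q hq => hi q (hsupp q hq)
    _ ≤ (M.outcome _ d₀ (τ (i + 1))).expect (M.safeValue S b 0) :=
        hg.expect_safeValue_le hone _ _ (hτsucc i) (hdτ i)
    _ ≤ (M.outcome _ d₀ (τ (i + 1))).expect (S.indicator 1) :=
        ProbDist.expect_mono _ (safeValue_zero_le hb hb1)

end DeadlineStrategy

section RecurrentDist

variable {Q A : Type*} [Fintype Q] [Fintype A] {M : MDP Q A} {d₀ e : ProbDist Q}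

/-- The distributions such that each of their neighbourhoods can be visited infinitely often from
`d₀`, by a strategy that may depend on the neighbourhood. -/
def recurrentDists (M : MDP Q A) (d₀ : ProbDist Q) : Set (ProbDist Q) :=
  closure {e | ∃ α : M.Strategy, MapClusterPt e atTop (M.outcome α d₀)}

theorem exists_frequently_of_mem_recurrentDists (he : e ∈ M.recurrentDists d₀)
    {p : ProbDist Q → Prop} (hp : ∀ᶠ X in 𝓝 e, p X) :
    ∃ α : M.Strategy, ∃ᶠ n in atTop, p (M.outcome α d₀ n) := by
  obtain ⟨e', ⟨α, hα⟩, hpe'⟩ :=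
    ((mem_closure_iff_frequently.1 he).and_eventually hp.eventually_nhds).exists
  exact ⟨α, hα.frequently hpe'⟩

theorem exists_mem_recurrentDists_sumOn_eq_one {T : Finset Q}
    (hd₀ : d₀ ∈ M.winLimitSureWeakly (sumOn T)) : ∃ e ∈ M.recurrentDists d₀, sumOn T e = 1 := by
  have hcont : Continuous (sumOn (Q := Q) T) :=
    (ProbDist.continuous_expect_left _).congr fun X => X.expect_indicator_one T
  have hle (X : ProbDist Q) : sumOn T X ≤ 1 := by
    rw [← X.expect_indicator_one]
    exact X.expect_le_one (indicator_one_le_one _)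
  have hmem (ε : ℝ) (hε : 0 < ε) : ∃ e ∈ M.recurrentDists d₀, 1 - ε ≤ sumOn T e := by
    obtain ⟨α, hα⟩ := hd₀ ε hε
    obtain ⟨e, he, hcl⟩ := (isClosed_le continuous_const hcont).isCompact
      |>.exists_mapClusterPt_of_frequently (Nat.frequently_atTop_iff_infinite.2 hα)
    exact ⟨e, subset_closure ⟨α, hcl⟩, he⟩
  obtain ⟨e₁, he₁, -⟩ := hmem 1 one_pos
  obtain ⟨e, he, hmax⟩ := isClosed_closure.isCompact.exists_isMaxOn ⟨e₁, he₁⟩ hcont.continuousOn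
  refine ⟨e, he, le_antisymm (hle e) (le_of_forall_sub_le fun ε hε => ?_)⟩
  obtain ⟨e', he', hε'⟩ := hmem ε hε
  exact hε'.trans (hmax he')

theorem eventually_lt_expect_indicator_support {ε : ℝ} (hε : 0 < ε) :
    ∀ᶠ X in 𝓝 e, 1 - ε < ProbDist.expect X (e.support.indicator 1) := by
  refine (ProbDist.continuous_expect_left _).continuousAt.eventually_const_lt ?_
  exact (sub_lt_self 1 hε).trans_eq e.expect_indicator_support.symm

theorem isLimitRecurrent_support [Nonempty A] (he : e ∈ M.recurrentDists d₀) :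
    M.IsLimitRecurrent e.support := by
  intro ε hε
  obtain ⟨c, hc, -, hce⟩ := exists_pos_le_of_pos fun q => e.1 q
  have hnear : ∀ᶠ X in 𝓝 e, ∀ q, 0 < e.1 q → c / 2 < X.1 q := by
    refine eventually_all.2 fun q => ?_
    by_cases hq : 0 < e.1 q
    · filter_upwards [((continuous_apply q).comp continuous_subtype_val).continuousAt
        |>.eventually_const_lt ((half_lt_self hc).trans_le (hce q hq))] with X hX _ using hX
    · exact Eventually.of_forall fun X h => absurd h hq
  obtain ⟨α, hα⟩ := exists_frequently_of_mem_recurrentDists he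
    (hnear.and (eventually_lt_expect_indicator_support (mul_pos (half_pos hc) hε)))
  obtain ⟨m, hm, -⟩ := hα.exists
  obtain ⟨n, hmn, -, hn⟩ := frequently_atTop'.1 hα m
  obtain ⟨k, rfl⟩ := Nat.exists_eq_add_of_le hmn.le
  refine ⟨k, Nat.lt_add_right_iff_pos.1 hmn, fun q hq => ?_⟩
  have hloss : c / 2 * (1 - M.hitValue e.support k q) ≤ c / 2 * ε := by
    calc c / 2 * (1 - M.hitValue e.support k q)
        ≤ (M.outcome α d₀ m).1 q * (1 - M.hitValue e.support k q) :=
          mul_le_mul_of_nonneg_right (hm q hq).le (sub_nonneg.2 (M.hitValue_le_one _ k q))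
      _ ≤ 1 - (M.outcome α d₀ m).expect (M.hitValue e.support k) :=
          ProbDist.mul_one_sub_le_one_sub_expect _ (M.hitValue_le_one _ k) q
      _ ≤ 1 - (M.outcome α d₀ (m + k)).expect (e.support.indicator 1) :=
          sub_le_sub_left (M.expect_outcome_add_le α d₀ _ m k) 1
      _ ≤ c / 2 * ε := by linarith
  linarith [le_of_mul_le_mul_left hloss (half_pos hc)]

theorem exists_le_expect_hitValue_support (he : e ∈ M.recurrentDists d₀) {ε : ℝ} (hε : 0 < ε) :
    ∃ n, 1 - ε ≤ d₀.expect (M.hitValue e.support n) := by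
  obtain ⟨α, hα⟩ := exists_frequently_of_mem_recurrentDists he
    (eventually_lt_expect_indicator_support hε)
  obtain ⟨n, hn⟩ := hα.exists
  have := M.expect_outcome_add_le α d₀ (e.support.indicator 1) 0 n
  rw [zero_add, outcome_zero] at this
  exact ⟨n, hn.le.trans this⟩

end RecurrentDist

end MDP

theorem mainTheorem1 {Q A : Type*} [Fintype Q] [Fintype A] (M : MDP Q A) (T : Finset Q) :
    M.winLimitSureWeakly (sumOn T) = M.winAlmostSureWeakly (sumOn T) := by
  refine Set.Subset.antisymm (fun d₀ hd₀ => ?_) fun d₀ ⟨α, hα⟩ ε hε => ⟨α, hα ε hε⟩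
  obtain ⟨e, he, heT⟩ := MDP.exists_mem_recurrentDists_sumOn_eq_one hd₀
  have : Nonempty A := by
    obtain ⟨α, -⟩ := hd₀ 1 one_pos
    obtain ⟨q⟩ := d₀.nonempty
    exact (α (.nil q)).nonempty
  obtain ⟨r, hr, hS⟩ := (MDP.isLimitRecurrent_support he).exists_isPeriodicallyRecurrent
  obtain ⟨j, hj⟩ := MDP.exists_expect_limitValue_eq_one hS hr fun ε hε =>
    MDP.exists_le_expect_hitValue_support he hε
  obtain ⟨b, hb, hb1, g, hg⟩ := MDP.exists_isSafePolicy hS hr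
  obtain ⟨α, hα⟩ := hg.exists_frequently_le_expect hS hr hb hb1 hj
  refine ⟨α, fun ε hε => Nat.frequently_atTop_iff_infinite.1 ((hα ε hε).mono fun t ht => ?_)⟩
  exact ht.trans (ProbDist.expect_indicator_le_sumOn _ (e.sumOn_eq_one_iff.1 heT))
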